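/- Let $(M,g)$ be a smooth Riemannian manifold of dimension $n$ (positive-definite $g$) with Levi-Civita connection $\hat\nabla$, and let $K$ be a smooth $(1,2)$-tensor on $M$, written $K_XY=K(X,Y)$, such that the $(0,3)$-tensor $$C(X,Y,Z)=g(K(X,Y),Z)$$ is symmetric in $X,Y,Z$; that is, $(M,g,K)$ is a statistical manifold. Suppose that $K$ is non-degenerate, i.e. at every point $p$ the linear map $X\mapsto K_X$ on $T_pM$ is injective, and that $[K,K]=0$, i.e. $K_XK_YZ=K_YK_XZ$ for all $X,Y,Z$. A canonical idempotent frame on an open set $U\subseteq M$ is a frame $u_1,\dots,u_n$ of smooth vector fields on $U$ with $K(u_i,u_i)=u_i$ for all $i$ and $K(u_i,u_j)=0$ for $i\neq j$. Then: 1. Every point of $M$ has an open neighbourhood that carries a canonical idempotent frame. 2. For every open $U\subseteq M$ and every canonical idempotent frame $u_1,\dots,u_n$ on $U$, one has $\hat\nabla C=0$ on $U$ if and only if $\hat\nabla u_i=0$ on $U$ for all $i$. Moreover, $\hat\nabla C=0$ on $M$ if and only if, for every canonical idempotent frame $u_1,\dots,u_n$ on an open subset $U$ of $M$, $\hat\nabla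 u_i=0$ on $U$ for all $i$. 3. In particular, if $\hat\nabla C=0$ on $M$, then $g$ is flat, i.e. the curvature tensor $\hat R(X,Y)Z=\hat\nabla_X\hat\nabla_YZ-\hat\nabla_Y\hat\nabla_XZ-\hat\nabla_{[X,Y]}Z$ vanishes identically. -/

import Mathlib

open scoped Manifold ContDiff
open Bundle

noncomputable section

namespace StatManifold

section

variable {E : Type*} [NormedAddCommGroup E] [NormedSpace ℝ E] [FiniteDimensional ℝ E]
  (M : Type*) [TopologicalSpace M] [ChartedSpace E M]
  [IsManifold 𝓘(ℝ, E) ∞ M]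

/-- Affine connections on the tangent bundle of `M`. For `D : Connection M`, a vector field `Y`, a
point `x` and `v ∈ T_x M`, the tangent vector `D Y x v` is `(∇_v Y)(x)`. -/
abbrev Connection : Type _ :=
  CovariantDerivative 𝓘(ℝ, E) E (fun x : M => TangentSpace 𝓘(ℝ, E) x)

/-- Pointwise `(1,2)`-tensors on `M`: `K x X Y` is `K_X Y ∈ T_x M` for `X, Y ∈ T_x M`. Smoothness
is imposed separately. -/
abbrev Tensor12 : Type _ :=
  (x : M) → TangentSpace 𝓘(ℝ, E) x →L[ℝ] TangentSpace 𝓘(ℝ, E) x →L[ℝ] TangentSpace 𝓘(ℝ, E) x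

end

section

variable {E : Type*} [NormedAddCommGroup E] [NormedSpace ℝ E] [FiniteDimensional ℝ E]
  {M : Type*} [TopologicalSpace M] [ChartedSpace E M]
  [IsManifold 𝓘(ℝ, E) ∞ M]

/-- `K` is a smooth section of `Hom(TM, Hom(TM, TM))`. -/
def SmoothTensor12 (K : Tensor12 (E := E) M) : Prop :=
  ContMDiff 𝓘(ℝ, E) (𝓘(ℝ, E).prod 𝓘(ℝ, E →L[ℝ] E →L[ℝ] E)) ∞
    (fun x : M => TotalSpace.mk' (E →L[ℝ] E →L[ℝ] E)
      (E := fun x : M =>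
        TangentSpace 𝓘(ℝ, E) x →L[ℝ] TangentSpace 𝓘(ℝ, E) x →L[ℝ] TangentSpace 𝓘(ℝ, E) x)
      x (K x))

/-- `K` is non-degenerate: at every point, `X ↦ K_X` is injective. -/
def Nondegenerate (K : Tensor12 (E := E) M) : Prop :=
  ∀ x : M, Function.Injective (K x)

/-- The `(1,3)`-tensor `[K,K](X,Y)Z = K_X K_Y Z - K_Y K_X Z`. -/
def bracket (K : Tensor12 (E := E) M) (x : M) (X Y Z : TangentSpace 𝓘(ℝ, E) x) :
    TangentSpace 𝓘(ℝ, E) x :=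
  K x X (K x Y Z) - K x Y (K x X Z)

/-- The smooth vector fields `u 1, …, u n` on the set `U` form a frame of canonical idempotents
for the product `X ∘ Y = K(X, Y)`: `u i ∘ u i = u i`, and `u i ∘ u j = 0` for `i ≠ j`.
Values of `u i` outside `U` are irrelevant. -/
structure IsCanonicalFrameOn (K : Tensor12 (E := E) M)
    (u : Fin (Module.finrank ℝ E) → (x : M) → TangentSpace 𝓘(ℝ, E) x) (U : Set M) : Prop where
  frame : IsLocalFrameOn 𝓘(ℝ, E) E ∞ u U
  idem : ∀ i, ∀ x ∈ U, K x (u i x) (u i x) = u i x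
  orth : ∀ i j, i ≠ j → ∀ x ∈ U, K x (u i x) (u j x) = 0

/-- The vector fields `u i` are parallel on `U`: `∇ u_i = 0` there, for all `i`. -/
def ParallelFieldsOn (D : Connection (E := E) M)
    (u : Fin (Module.finrank ℝ E) → (x : M) → TangentSpace 𝓘(ℝ, E) x) (U : Set M) : Prop :=
  ∀ i, ∀ x ∈ U, D (u i) x = 0

/-- The curvature `R(X,Y)Z = ∇_X ∇_Y Z - ∇_Y ∇_X Z - ∇_[X,Y] Z` of a connection, on vector
fields, at the point `x`. -/
def curvature (D : Connection (E := E) M)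
    (X Y Z : (x : M) → TangentSpace 𝓘(ℝ, E) x) (x : M) : TangentSpace 𝓘(ℝ, E) x :=
  D (fun y => D Z y (Y y)) x (X x) - D (fun y => D Z y (X y)) x (Y x)
    - D Z x (VectorField.mlieBracket 𝓘(ℝ, E) X Y x)

/-- The connection is flat: `R(X,Y)Z = 0` for all smooth vector fields `X, Y, Z` on `M`. -/
def IsFlat (D : Connection (E := E) M) : Prop :=
  ∀ X Y Z : (x : M) → TangentSpace 𝓘(ℝ, E) x,
    CMDiff ∞ (T% X) → CMDiff ∞ (T% Y) → CMDiff ∞ (T% Z) →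
      ∀ x : M, curvature D X Y Z x = 0

end

section

variable {E : Type*} [NormedAddCommGroup E] [NormedSpace ℝ E] [FiniteDimensional ℝ E]
  {M : Type*} [TopologicalSpace M] [ChartedSpace E M]
  [IsManifold 𝓘(ℝ, E) ∞ M] [RiemannianBundle (fun x : M => TangentSpace 𝓘(ℝ, E) x)]

/-- The `(0,3)`-tensor `C(X,Y,Z) = g(K(X,Y),Z)`. -/
def cubic (K : Tensor12 (E := E) M) (x : M) (X Y Z : TangentSpace 𝓘(ℝ, E) x) : ℝ :=
  inner ℝ (K x X Y) Z

/-- `(M, g, K)` is a statistical manifold: `K` is a smooth `(1,2)`-tensor and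
`C(X,Y,Z) = g(K(X,Y),Z)` is symmetric in `X, Y, Z` (the two transpositions below generate all
permutations). -/
structure IsStatistical (K : Tensor12 (E := E) M) : Prop where
  smooth : SmoothTensor12 K
  swap₁₂ : ∀ (x : M) (X Y Z : TangentSpace 𝓘(ℝ, E) x), cubic K x X Y Z = cubic K x Y X Z
  swap₂₃ : ∀ (x : M) (X Y Z : TangentSpace 𝓘(ℝ, E) x), cubic K x X Y Z = cubic K x X Z Y

/-- `D` is the Levi-Civita connection of `g`, i.e. the torsion-free metric connection:
`∇_X Y - ∇_Y X = [X, Y]` and `w(g(X,Y)) = g(∇_w X, Y) + g(X, ∇_w Y)`. -/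
structure IsLeviCivita (D : Connection (E := E) M) : Prop where
  torsionFree : ∀ (x : M) (X Y : (x : M) → TangentSpace 𝓘(ℝ, E) x),
    MDiffAt (T% X) x → MDiffAt (T% Y) x →
      D Y x (X x) - D X x (Y x) = VectorField.mlieBracket 𝓘(ℝ, E) X Y x
  metric : ∀ (x : M) (w : TangentSpace 𝓘(ℝ, E) x) (X Y : (x : M) → TangentSpace 𝓘(ℝ, E) x),
    MDiffAt (T% X) x → MDiffAt (T% Y) x →
      mvfderiv 𝓘(ℝ, E) (fun y => inner ℝ (X y) (Y y)) x w =
        inner ℝ (D X x w) (Y x) + inner ℝ (X x) (D Y x w)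

/-- `(∇_w C)(X,Y,Z) = w(C(X,Y,Z)) - C(∇_w X,Y,Z) - C(X,∇_w Y,Z) - C(X,Y,∇_w Z)` for vector fields
`X, Y, Z` and a tangent vector `w` at `x`. -/
def covDerivCubic (D : Connection (E := E) M) (K : Tensor12 (E := E) M) (x : M)
    (w : TangentSpace 𝓘(ℝ, E) x) (X Y Z : (x : M) → TangentSpace 𝓘(ℝ, E) x) : ℝ :=
  mvfderiv 𝓘(ℝ, E) (fun y => cubic K y (X y) (Y y) (Z y)) x w
    - cubic K x (D X x w) (Y x) (Z x)
    - cubic K x (X x) (D Y x w) (Z x)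
    - cubic K x (X x) (Y x) (D Z x w)

/-- `∇C = 0` at every point of `U`. The value `(∇_w C)(X,Y,Z)` is tensorial, so it is tested on all
vector fields that are differentiable at the point in question. -/
def ParallelCubicOn (D : Connection (E := E) M) (K : Tensor12 (E := E) M) (U : Set M) : Prop :=
  ∀ x ∈ U, ∀ (w : TangentSpace 𝓘(ℝ, E) x) (X Y Z : (x : M) → TangentSpace 𝓘(ℝ, E) x),
    MDiffAt (T% X) x → MDiffAt (T% Y) x → MDiffAt (T% Z) x →
      covDerivCubic D K x w X Y Z = 0

end

end StatManifold

end

open scoped Manifold ContDiff Topology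
open Bundle Filter

/-! Write X ∘ Y = K(X, Y). Symmetry of C and [K,K] = 0 make ∘ commutative and associative with
self-adjoint, commuting multiplications, so these diagonalise simultaneously. Non-degeneracy lets
joint eigenvectors be rescaled to idempotents (`exists_basis_idempotents`). Idempotents solve e ∘ e
= e, whose linearisation at a solution is invertible, so the implicit function theorem spreads them
smoothly to nearby points (`exists_analytic_orthogonal_idempotents`,
`exists_isLocalFrameOn_idempotents`).

In such a frame C is diagonal: C = Σ g(·,u_i)³ / g(u_i,u_i)². If all u_i are parallel, so is C.
Conversely, differentiating C(u_i,u_i,u_j) = g(u_i,u_j) with ∇C = 0 yields ∇u_i = 2 u_i ∘ ∇u_i, and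
multiplying by u_i forces ∇u_i = 0.

For flatness, g(R(X,Y)Z, u_i) with u_i parallel equals X(Yφ) − Y(Xφ) − [X,Y]φ for φ = g(Z,u_i). It
vanishes because the bracket is the commutator of derivations (`mvfderiv_mlieBracket_apply`). -/

namespace StatManifold

set_option linter.unusedSectionVars false

/-! ### Idempotents of commutative associative products, and their perturbation. -/

section Algebra

/-- A commutative product with commuting, symmetric and injective multiplication operators on a
Euclidean space admits a basis of pairwise orthogonal idempotents. -/
theorem exists_basis_idempotents {V : Type*} [NormedAddCommGroup V] [InnerProductSpace ℝ V]
    [FiniteDimensional ℝ V] (m : V →ₗ[ℝ] V →ₗ[ℝ] V) (hcomm : ∀ x y, m x y = m y x)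
    (hsymm : ∀ x, (m x).IsSymmetric) (hm : ∀ x y z, m x (m y z) = m y (m x z))
    (hinj : Function.Injective m) :
    ∃ b : Module.Basis (Fin (Module.finrank ℝ V)) ℝ V,
      (∀ i, m (b i) (b i) = b i) ∧ ∀ i j, i ≠ j → m (b i) (b j) = 0 := by
  classical
  -- `S` consists of the joint eigenvectors; the spectral theorem for commuting symmetric operators
  -- makes them span.
  let S : Set V := {v | ∃ l : V → ℝ, ∀ x, m x v = l x • v}
  have hS : ⊤ ≤ Submodule.span ℝ S := by
    rw [← LinearMap.IsSymmetric.iSup_iInf_eq_top_of_commute (T := fun x => m x) hsymm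
      (fun x y _ => LinearMap.ext fun z => hm x y z)]
    refine iSup_le fun l v hv => Submodule.subset_span ⟨l, fun x => ?_⟩
    exact Module.End.mem_eigenspace_iff.mp ((Submodule.mem_iInf _).mp hv x)
  let b₀ := Module.Basis.ofSpan hS
  let e := Fintype.equivFinOfCardEq (Module.finrank_eq_card_basis b₀).symm
  let b := b₀.reindex e
  have hb : ∀ i, ∃ l : V → ℝ, ∀ x, m x (b i) = l x • b i := fun i =>
    Module.Basis.ofSpan_subset hS ⟨e.symm i, by simp [b, b₀]⟩
  choose l hl using hb
  -- The product of `b i` and `b j` is a multiple of each of them, hence zero.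
  have hne : ∀ i j, i ≠ j → m (b i) (b j) = 0 := by
    intro i j hij
    have h1 := hl j (b i)
    have h2 := (hcomm _ _).trans (hl i (b j))
    have h3 : l j (b i) • b j - l i (b j) • b i = 0 := by rw [← h1, ← h2, sub_self]
    have h4 := congrArg (fun v => b.repr v j) h3
    simp [hij] at h4
    rw [h1, h4, zero_smul]
  -- Otherwise `b i` would annihilate the whole basis, against injectivity. Dividing `b i` by this
  -- eigenvalue makes it idempotent.
  have hnz : ∀ i, l i (b i) ≠ 0 := by
    intro i h0
    refine b.ne_zero i (hinj ?_)
    rw [map_zero]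
    refine b.ext fun j => ?_
    rcases eq_or_ne i j with rfl | hij
    · rw [hl, h0, zero_smul, LinearMap.zero_apply]
    · exact hne i j hij
  refine ⟨b.unitsSMul fun i => (Units.mk0 _ (hnz i))⁻¹, fun i => ?_, fun i j hij => ?_⟩
  · simp [Module.Basis.unitsSMul_apply, Units.smul_def, hl, smul_smul, hnz i]
  · simp [Module.Basis.unitsSMul_apply, Units.smul_def, hne i j hij]

/-- Nonzero pairwise orthogonal idempotents of a bilinear product are linearly independent. -/
theorem linearIndependent_of_orthogonal_idempotents {V ι : Type*} [AddCommGroup V] [Module ℝ V]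
    (m : V →ₗ[ℝ] V →ₗ[ℝ] V) (u : ι → V) (hne : ∀ i, u i ≠ 0)
    (hidem : ∀ i, m (u i) (u i) = u i) (horth : ∀ i j, i ≠ j → m (u i) (u j) = 0) :
    LinearIndependent ℝ u := by
  classical
  refine linearIndependent_iff'.mpr fun s a h i hi => ?_
  have h1 := congrArg (m (u i)) h
  rw [map_sum, map_zero, Finset.sum_eq_single i] at h1
  · simpa [hidem, hne i] using h1
  · intro j _ hj
    rw [map_smul, horth i j hj.symm, smul_zero]
  · exact fun h => absurd hi h

variable {E : Type*} [NormedAddCommGroup E] [NormedSpace ℝ E]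

/-- A bounded bilinear product is commutative, with commuting multiplication operators. -/
structure IsCommutingProduct (k : E →L[ℝ] E →L[ℝ] E) : Prop where
  comm : ∀ x y, k x y = k y x
  left_comm : ∀ x y z, k x (k y z) = k y (k x z)

theorem IsCommutingProduct.assoc {k : E →L[ℝ] E →L[ℝ] E} (h : IsCommutingProduct k) (x y z : E) :
    k (k x y) z = k x (k y z) := by
  rw [h.comm, h.left_comm, h.comm z y]

/-- With z = x and w = y in the middle exchange, products of idempotents are seen to be idempotent.
-/
theorem IsCommutingProduct.mul_mul_mul_comm {k : E →L[ℝ] E →L[ℝ] E} (h : IsCommutingProduct k)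
    (x y z w : E) : k (k x y) (k z w) = k (k x z) (k y w) := by
  rw [h.assoc, h.left_comm y, ← h.assoc x]

/-- An idempotent whose multiplication operator is a strict contraction vanishes. -/
theorem eq_zero_of_idempotent_of_norm_lt {k : E →L[ℝ] E →L[ℝ] E} {w : E} (hw : k w w = w)
    (h : ‖k w‖ < 1) : w = 0 := by
  by_contra h0
  have h1 : 0 < ‖w‖ := norm_pos_iff.mpr h0
  have h2 : ‖w‖ ≤ ‖k w‖ * ‖w‖ := by
    conv_lhs => rw [← hw]
    exact (k w).le_opNorm w
  nlinarith

/-- Implicit function theorem for an equation `f (a, v) = 0` whose partial derivative in `v` is an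
involution. -/
theorem exists_analytic_solution [CompleteSpace E] {A : Type*} [NormedAddCommGroup A]
    [NormedSpace ℝ A] [CompleteSpace A] {f : A × E → E} {a₀ : A} {e₀ : E}
    (hf : ContDiffAt ℝ ω f (a₀, e₀)) (h₀ : f (a₀, e₀) = 0) {T : E →L[ℝ] E}
    (hT : HasFDerivAt (fun v => f (a₀, v)) T e₀) (hTT : ∀ v, T (T v) = v) :
    ∃ φ : A → E, φ a₀ = e₀ ∧ ContDiffAt ℝ ω φ a₀ ∧ ∀ᶠ a in 𝓝 a₀, f (a, φ a) = 0 := by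
  have hval : fderiv ℝ f (a₀, e₀) ∘L .inr ℝ A E = T :=
    (HasFDerivAt.comp e₀ (hf.differentiableAt (by simp)).hasFDerivAt
      (hasFDerivAt_prodMk_right a₀ e₀)).unique hT
  have hinv : (fderiv ℝ f (a₀, e₀) ∘L .inr ℝ A E).IsInvertible := by
    rw [hval]
    exact ⟨ContinuousLinearEquiv.equivOfInverse T T hTT hTT, rfl⟩
  refine ⟨hf.implicitFunction (by simp) hinv, hf.implicitFunction_apply_self (by simp) hinv,
    hf.contDiffAt_implicitFunction (by simp) hinv, ?_⟩
  simpa only [h₀] using hf.eventually_apply_implicitFunction (by simp) hinv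

/-- An idempotent of a commutative associative product extends to an analytic family of idempotents
of all the nearby products. -/
theorem exists_analytic_idempotent [CompleteSpace E] {k₀ : E →L[ℝ] E →L[ℝ] E}
    (hk : IsCommutingProduct k₀) {e₀ : E} (he : k₀ e₀ e₀ = e₀) :
    ∃ φ : (E →L[ℝ] E →L[ℝ] E) → E, φ k₀ = e₀ ∧ ContDiffAt ℝ ω φ k₀ ∧
      ∀ᶠ k in 𝓝 k₀, k (φ k) (φ k) = φ k := by
  have hf : ContDiff ℝ ω (fun p : (E →L[ℝ] E →L[ℝ] E) × E => p.1 p.2 p.2 - p.2) :=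
    ((contDiff_fst.clm_apply contDiff_snd).clm_apply contDiff_snd).sub contDiff_snd
  have hd : HasFDerivAt (fun w : E => k₀ w w - w) ((2 : ℝ) • k₀ e₀ - .id ℝ E) e₀ := by
    convert! (k₀.hasFDerivAt.clm_apply (hasFDerivAt_id e₀)).sub (hasFDerivAt_id e₀) using 1
    ext v
    simp [hk.comm v e₀, two_smul]
  -- L = `k₀ e₀` is a projection, so the partial derivative 2L − 1 squares to 4L² − 4L + 1 = 1.
  have hP : ∀ v, k₀ e₀ (k₀ e₀ v) = k₀ e₀ v := fun v => by rw [← hk.assoc, he]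
  obtain ⟨φ, h0, h1, h2⟩ := exists_analytic_solution hf.contDiffAt (by simp [he]) hd (fun v => by
    simp only [sub_apply, smul_apply,
      ContinuousLinearMap.id_apply, map_sub, map_smul, hP]
    module)
  exact ⟨φ, h0, h1, h2.mono fun k hk => sub_eq_zero.mp hk⟩

/-- Supplies the smallness needed by `eq_zero_of_idempotent_of_norm_lt`, by continuity from a
product that vanishes at `x₀`. -/
theorem eventually_norm_mul_lt_one {X : Type*} [TopologicalSpace X] {x₀ : X}
    {k : X → E →L[ℝ] E →L[ℝ] E} {v w : X → E} (hk : ContinuousAt k x₀) (hv : ContinuousAt v x₀)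
    (hw : ContinuousAt w x₀) (h₀ : k x₀ (v x₀) (w x₀) = 0) :
    ∀ᶠ x in 𝓝 x₀, ‖k x (k x (v x) (w x))‖ < 1 := by
  have hc : ContinuousAt (fun x => ‖k x (k x (v x) (w x))‖) x₀ :=
    (hk.clm_apply ((hk.clm_apply hv).clm_apply hw)).norm
  exact hc.eventually_lt continuousAt_const (by simp [h₀])

/-- A family of pairwise orthogonal nonzero idempotents of a commutative associative product extends
to an analytic family for all the nearby commutative associative products. -/
theorem exists_analytic_orthogonal_idempotents [CompleteSpace E] {ι : Type*} [Finite ι]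
    {k₀ : E →L[ℝ] E →L[ℝ] E} (hk : IsCommutingProduct k₀) {e : ι → E} (hne : ∀ i, e i ≠ 0)
    (hidem : ∀ i, k₀ (e i) (e i) = e i) (horth : ∀ i j, i ≠ j → k₀ (e i) (e j) = 0) :
    ∃ φ : ι → (E →L[ℝ] E →L[ℝ] E) → E, ∀ᶠ k in 𝓝 k₀, ∀ i, ContDiffAt ℝ ω (φ i) k ∧ φ i k ≠ 0 ∧
      k (φ i k) (φ i k) = φ i k ∧
      (IsCommutingProduct k → ∀ j, i ≠ j → k (φ i k) (φ j k) = 0) := by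
  choose φ hφ₀ hφ hφi using fun i => exists_analytic_idempotent hk (hidem i)
  refine ⟨φ, eventually_all.mpr fun i => ?_⟩
  -- Idempotents cannot be small without vanishing: the product of `φ i k` and `φ j k` is zero at
  -- `k₀`, small nearby, and idempotent when `k` is commuting, so it stays exactly zero.
  have hall : ∀ᶠ k in 𝓝 k₀, ∀ j, i ≠ j → ‖k (k (φ i k) (φ j k))‖ < 1 := by
    refine eventually_all.mpr fun j => ?_
    by_cases hij : i = j
    · exact Eventually.of_forall fun k h => absurd hij h
    · refine (eventually_norm_mul_lt_one (k := fun k => k) continuousAt_id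
        (hφ i).continuousAt (hφ j).continuousAt ?_).mono fun k h _ => h
      rw [hφ₀, hφ₀]
      exact horth i j hij
  filter_upwards [(hφ i).eventually (by simp), eventually_all.mpr hφi, hall,
    (hφ i).continuousAt.eventually_ne (by rw [hφ₀]; exact hne i)] with k h1 h2 h3 h4
  refine ⟨h1, h4, h2 i, fun hkc j hij => eq_zero_of_idempotent_of_norm_lt ?_ (h3 j hij)⟩
  rw [hkc.mul_mul_mul_comm, h2, h2]

end Algebra

/-! ### From one fibre to a smooth local frame. -/

section Coordinates

variable {E : Type*} [NormedAddCommGroup E] [NormedSpace ℝ E]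
  {M : Type*} [TopologicalSpace M] [ChartedSpace E M]
  {F : Type*} [NormedAddCommGroup F] [NormedSpace ℝ F]
  {V : M → Type*} [TopologicalSpace (TotalSpace F V)] [∀ x, AddCommGroup (V x)]
  [∀ x, Module ℝ (V x)] [∀ x, TopologicalSpace (V x)] [∀ x, IsTopologicalAddGroup (V x)]
  [∀ x, ContinuousSMul ℝ (V x)] [FiberBundle F V] [VectorBundle ℝ F V]
  [ContMDiffVectorBundle ∞ F V 𝓘(ℝ, E)]

/-- A smooth family of bilinear products on the fibres of a vector bundle is smooth in
coordinates. -/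
theorem exists_contMDiffAt_coordinates {K : (x : M) → V x →L[ℝ] V x →L[ℝ] V x}
    (hK : ContMDiff 𝓘(ℝ, E) (𝓘(ℝ, E).prod 𝓘(ℝ, F →L[ℝ] F →L[ℝ] F)) ∞
      (fun x : M => TotalSpace.mk' (F →L[ℝ] F →L[ℝ] F)
        (E := fun x : M => V x →L[ℝ] V x →L[ℝ] V x) x (K x))) (p : M) :
    ∃ k : M → F →L[ℝ] F →L[ℝ] F, ∀ x ∈ (trivializationAt F V p).baseSet,
      ContMDiffAt 𝓘(ℝ, E) 𝓘(ℝ, F →L[ℝ] F →L[ℝ] F) ∞ k x ∧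
      ∀ v w, k x v w = (trivializationAt F V p).continuousLinearMapAt ℝ x
          (K x ((trivializationAt F V p).symmL ℝ x v) ((trivializationAt F V p).symmL ℝ x w)) := by
  have : ∀ x, ContinuousAdd (V x →L[ℝ] V x) := fun x => inferInstance
  let eK := trivializationAt (F →L[ℝ] F →L[ℝ] F) (fun x : M => V x →L[ℝ] V x →L[ℝ] V x) p
  refine ⟨fun x => (eK ⟨x, K x⟩).2, fun x hx => ⟨?_, fun v w => ?_⟩⟩
  -- The base set of the Hom-bundle trivialization is a triple intersection, one factor per copy of
  -- `V`.
  · have hx' : x ∈ eK.baseSet := ⟨hx, hx, hx⟩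
    exact (eK.contMDiffAt_section_iff hx').mp (hK x)
  · exact (inCoordinates_apply_eq₂ hx hx hx).trans
      (by simp [Trivialization.coe_linearMapAt_of_mem, hx])

/-- Pairwise orthogonal idempotents forming a basis of one fibre extend to a smooth local frame of
idempotents. -/
theorem exists_isLocalFrameOn_idempotents [FiniteDimensional ℝ F]
    {K : (x : M) → V x →L[ℝ] V x →L[ℝ] V x}
    (hK : ContMDiff 𝓘(ℝ, E) (𝓘(ℝ, E).prod 𝓘(ℝ, F →L[ℝ] F →L[ℝ] F)) ∞
      (fun x : M => TotalSpace.mk' (F →L[ℝ] F →L[ℝ] F)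
        (E := fun x : M => V x →L[ℝ] V x →L[ℝ] V x) x (K x)))
    (hcomm : ∀ x X Y, K x X Y = K x Y X)
    (hleft : ∀ x X Y Z, K x X (K x Y Z) = K x Y (K x X Z))
    {ι : Type*} [Fintype ι] (hι : Fintype.card ι = Module.finrank ℝ F) {p : M} {b : ι → V p}
    (hb : ∀ i, b i ≠ 0) (hidem : ∀ i, K p (b i) (b i) = b i)
    (horth : ∀ i j, i ≠ j → K p (b i) (b j) = 0) :
    ∃ (U : Set M) (u : ι → (x : M) → V x), IsOpen U ∧ p ∈ U ∧ IsLocalFrameOn 𝓘(ℝ, E) F ∞ u U ∧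
      (∀ i, ∀ x ∈ U, K x (u i x) (u i x) = u i x) ∧
      ∀ i j, i ≠ j → ∀ x ∈ U, K x (u i x) (u j x) = 0 := by
  have : CompleteSpace F := FiniteDimensional.complete ℝ F
  let e := trivializationAt F V p
  have hp : p ∈ e.baseSet := mem_baseSet_trivializationAt F V p
  obtain ⟨k, hk⟩ := exists_contMDiffAt_coordinates hK p
  have hsymm : ∀ x ∈ e.baseSet, ∀ v : V x, e.symmL ℝ x (e.continuousLinearMapAt ℝ x v) = v :=
    fun x hx v => e.symmL_continuousLinearMapAt hx v
  have happ : ∀ x ∈ e.baseSet, ∀ v w, e.symmL ℝ x (k x v w) =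
      K x (e.symmL ℝ x v) (e.symmL ℝ x w) := fun x hx v w => by
    rw [(hk x hx).2, hsymm x hx]
  have hinj : ∀ x ∈ e.baseSet, Function.Injective (e.symmL ℝ x) := fun x hx =>
    Function.LeftInverse.injective (g := e.continuousLinearMapAt ℝ x)
      fun v => e.continuousLinearMapAt_symmL hx v
  have hkc : ∀ x ∈ e.baseSet, IsCommutingProduct (k x) := fun x hx =>
    ⟨fun v w => hinj x hx (by rw [happ x hx, happ x hx, hcomm]),
      fun v w z => hinj x hx (by simp only [happ x hx]; rw [hleft])⟩
  obtain ⟨φ, hφ⟩ := exists_analytic_orthogonal_idempotents (hkc p hp)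
    (e := fun i => e.continuousLinearMapAt ℝ p (b i))
    (fun i h => hb i (by rw [← hsymm p hp (b i), h, map_zero]))
    (fun i => hinj p hp (by rw [happ p hp, hsymm p hp, hidem]))
    (fun i j hij => hinj p hp (by rw [happ p hp, hsymm p hp, hsymm p hp, horth i j hij, map_zero]))
  -- The analytic families live on the space of products; composing with the coordinate product `k`
  -- turns them into local sections near `p`.
  have hev := ((hk p hp).1.continuousAt.eventually hφ).and (e.open_baseSet.mem_nhds hp)
  obtain ⟨U, hU, hUo, hpU⟩ := eventually_nhds_iff.mp hev
  have hidem' : ∀ i, ∀ x ∈ U, K x (e.symmL ℝ x (φ i (k x))) (e.symmL ℝ x (φ i (k x))) =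
      e.symmL ℝ x (φ i (k x)) := fun i x hx => by
    rw [← happ x (hU x hx).2, ((hU x hx).1 i).2.2.1]
  have horth' : ∀ i j, i ≠ j → ∀ x ∈ U,
      K x (e.symmL ℝ x (φ i (k x))) (e.symmL ℝ x (φ j (k x))) = 0 := fun i j hij x hx => by
    rw [← happ x (hU x hx).2, ((hU x hx).1 i).2.2.2 (hkc x (hU x hx).2) j hij, map_zero]
  have hli : ∀ x ∈ U, LinearIndependent ℝ fun i => e.symmL ℝ x (φ i (k x)) := fun x hx =>
    linearIndependent_of_orthogonal_idempotents
      ((ContinuousLinearMap.coeLM ℝ).comp (K x).toLinearMap) _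
      (fun i h => ((hU x hx).1 i).2.1 (hinj x (hU x hx).2 (h.trans (map_zero _).symm)))
      (fun i => hidem' i x hx) (fun i j hij => horth' i j hij x hx)
  refine ⟨U, fun i x => e.symmL ℝ x (φ i (k x)), hUo, hpU, ⟨fun hx => hli _ hx, fun {x} hx => ?_,
    fun i x hx => ?_⟩, hidem', horth'⟩
  · let ψ := e.continuousLinearEquivAt ℝ x (hU x hx).2
    have : FiniteDimensional ℝ (V x) := Module.Finite.equiv ψ.symm.toLinearEquiv
    exact ((hli x hx).span_eq_top_of_card_eq_finrank' (hι.trans ψ.toLinearEquiv.finrank_eq.symm)).ge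
  · have hxe := (hU x hx).2
    refine ((e.contMDiffAt_section_iff hxe).mpr ?_).contMDiffWithinAt
    have h1 : ContMDiffAt 𝓘(ℝ, E) 𝓘(ℝ, F) ∞ (fun y => φ i (k y)) x :=
      (((hU x hx).1 i).1.of_le le_top).contMDiffAt.comp x (hk x hxe).1
    refine h1.congr_of_eventuallyEq ?_
    filter_upwards [e.open_baseSet.mem_nhds hxe] with y hy
    simp [e.symmL_apply hy, hy]

end Coordinates

/-! ### Derivatives of real functions on a manifold. -/

section

variable {E : Type*} [NormedAddCommGroup E] [NormedSpace ℝ E]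
  {M : Type*} [TopologicalSpace M] [ChartedSpace E M]

theorem mvfderiv_congr {f g : M → ℝ} {x : M} (h : f =ᶠ[𝓝 x] g) :
    mvfderiv 𝓘(ℝ, E) f x = mvfderiv 𝓘(ℝ, E) g x := by
  ext w
  simp only [mvfderiv, h.mfderiv_eq]
  rfl

theorem mvfderiv_finset_sum {ι : Type} (s : Finset ι) {f : ι → M → ℝ} {x : M}
    (hf : ∀ i ∈ s, MDiffAt (f i) x) (w : TangentSpace 𝓘(ℝ, E) x) :
    mvfderiv 𝓘(ℝ, E) (fun y => ∑ i ∈ s, f i y) x w = ∑ i ∈ s, mvfderiv 𝓘(ℝ, E) (f i) x w := by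
  classical
  induction s using Finset.induction_on with
  | empty => simp [mvfderiv_const]
  | insert a s ha ih =>
    have hs : MDifferentiableAt 𝓘(ℝ, E) 𝓘(ℝ, ℝ) (fun y => ∑ i ∈ s, f i y) x := by
      have h : MDifferentiableAt 𝓘(ℝ, E) 𝓘(ℝ, ℝ) (∑ i ∈ s, f i) x :=
        MDifferentiableAt.sum (f := f) (t := s) fun i hi => hf i (Finset.mem_insert_of_mem hi)
      simpa [Finset.sum_fn] using h
    simp only [Finset.sum_insert ha]
    rw [mvfderiv_fun_add (hf a (Finset.mem_insert_self a s)) hs,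
      ← ih fun i hi => hf i (Finset.mem_insert_of_mem hi)]
    rfl

theorem mvfderiv_inv_of_eq_zero {f : M → ℝ} {x : M} (hf : MDiffAt f x) (h0 : f x ≠ 0)
    (w : TangentSpace 𝓘(ℝ, E) x) (h : mvfderiv 𝓘(ℝ, E) f x w = 0) :
    mvfderiv 𝓘(ℝ, E) (fun y => (f y)⁻¹) x w = 0 := by
  have hi : MDifferentiableAt 𝓘(ℝ, E) 𝓘(ℝ, ℝ) (fun y => (f y)⁻¹) x := hf.inv h0
  have h1 : mvfderiv 𝓘(ℝ, E) (fun y => f y * (f y)⁻¹) x w = 0 := by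
    have hc : (fun y => f y * (f y)⁻¹) =ᶠ[𝓝 x] fun _ => (1 : ℝ) := by
      filter_upwards [hf.continuousAt.eventually_ne h0] with y hy
      exact mul_inv_cancel₀ hy
    rw [mvfderiv_congr hc, mvfderiv_const]
    rfl
  rw [mvfderiv_fun_mul hf hi] at h1
  simpa [h, h0] using h1

end

/-! ### Canonical frames on a statistical manifold, and parallelism. -/

section

variable {E : Type*} [NormedAddCommGroup E] [NormedSpace ℝ E] [FiniteDimensional ℝ E]
  {M : Type*} [TopologicalSpace M] [ChartedSpace E M]
  [IsManifold 𝓘(ℝ, E) ∞ M] [RiemannianBundle (fun x : M => TangentSpace 𝓘(ℝ, E) x)]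

namespace IsStatistical

variable {K : Tensor12 (E := E) M}

theorem inner_left (hK : IsStatistical K) (x : M) (X Y Z : TangentSpace 𝓘(ℝ, E) x) :
    inner ℝ (K x X Y) Z = inner ℝ Y (K x X Z) :=
  (hK.swap₂₃ x X Y Z).trans (real_inner_comm _ _)

theorem comm (hK : IsStatistical K) (x : M) (X Y : TangentSpace 𝓘(ℝ, E) x) :
    K x X Y = K x Y X :=
  ext_inner_right ℝ fun Z => hK.swap₁₂ x X Y Z

end IsStatistical

/-- Around every point of a statistical manifold with a non-degenerate commuting difference tensor
there is a canonical idempotent frame. -/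
theorem exists_isCanonicalFrameOn {K : Tensor12 (E := E) M} (hK : IsStatistical K)
    (hnd : Nondegenerate K) (hleft : ∀ x X Y Z, K x X (K x Y Z) = K x Y (K x X Z)) (p : M) :
    ∃ (U : Set M) (u : Fin (Module.finrank ℝ E) → (x : M) → TangentSpace 𝓘(ℝ, E) x),
      IsOpen U ∧ p ∈ U ∧ IsCanonicalFrameOn K u U := by
  have : FiniteDimensional ℝ (TangentSpace 𝓘(ℝ, E) p) := inferInstanceAs (FiniteDimensional ℝ E)
  obtain ⟨b, hidem, horth⟩ := exists_basis_idempotents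
    ((ContinuousLinearMap.coeLM ℝ).comp (K p).toLinearMap) (hK.comm p)
    (fun X Y Z => hK.inner_left p X Y Z) (hleft p)
    (fun X Y h => hnd p (ContinuousLinearMap.coe_injective h))
  obtain ⟨U, u, hU, hp, h1, h2, h3⟩ := exists_isLocalFrameOn_idempotents (F := E) hK.smooth hK.comm
    hleft (Fintype.card_fin _) (p := p) (b := b) b.ne_zero hidem horth
  exact ⟨U, u, hU, hp, h1, h2, h3⟩

section Frame

variable {K : Tensor12 (E := E) M} {U : Set M}
  {u : Fin (Module.finrank ℝ E) → (x : M) → TangentSpace 𝓘(ℝ, E) x}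

theorem IsCanonicalFrameOn.ne_zero (hu : IsCanonicalFrameOn K u U) {x : M} (hx : x ∈ U)
    (i : Fin (Module.finrank ℝ E)) : u i x ≠ 0 :=
  (hu.frame.linearIndependent hx).ne_zero i

theorem IsCanonicalFrameOn.inner_self_ne_zero (hu : IsCanonicalFrameOn K u U) {x : M} (hx : x ∈ U)
    (i : Fin (Module.finrank ℝ E)) : (inner ℝ (u i x) (u i x) : ℝ) ≠ 0 :=
  _root_.inner_self_ne_zero.mpr (hu.ne_zero hx i)

theorem IsCanonicalFrameOn.ext_inner (hu : IsCanonicalFrameOn K u U) {x : M} (hx : x ∈ U)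
    {v w : TangentSpace 𝓘(ℝ, E) x} (h : ∀ i, (inner ℝ v (u i x) : ℝ) = inner ℝ w (u i x)) :
    v = w :=
  InnerProductSpace.ext_inner_right_basis (𝕜 := ℝ) (hu.frame.toBasisAt hx) fun i => by
    simpa using h i

/-- Self-adjointness gives g(u_i, u_j) = g(u_i ∘ u_i, u_j) = g(u_i, u_i ∘ u_j) = 0. -/
theorem IsCanonicalFrameOn.inner_eq_zero (hK : IsStatistical K) (hu : IsCanonicalFrameOn K u U)
    {x : M} (hx : x ∈ U) {i j : Fin (Module.finrank ℝ E)} (hij : i ≠ j) :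
    (inner ℝ (u i x) (u j x) : ℝ) = 0 := by
  rw [← hu.idem i x hx, hK.inner_left, hu.orth i j hij x hx, inner_zero_right]

theorem IsCanonicalFrameOn.eq_sum (hK : IsStatistical K) (hu : IsCanonicalFrameOn K u U)
    {x : M} (hx : x ∈ U) (v : TangentSpace 𝓘(ℝ, E) x) :
    v = ∑ i, (inner ℝ v (u i x) * (inner ℝ (u i x) (u i x))⁻¹ : ℝ) • u i x := by
  refine hu.ext_inner hx fun j => ?_
  rw [sum_inner, Finset.sum_eq_single j]
  · rw [real_inner_smul_left, inv_mul_cancel_right₀ (hu.inner_self_ne_zero hx j)]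
  · intro i _ hij
    rw [real_inner_smul_left, hu.inner_eq_zero hK hx hij, mul_zero]
  · simp

theorem IsCanonicalFrameOn.apply_left (hK : IsStatistical K) (hu : IsCanonicalFrameOn K u U)
    {x : M} (hx : x ∈ U) (v : TangentSpace 𝓘(ℝ, E) x) (i : Fin (Module.finrank ℝ E)) :
    K x v (u i x) = (inner ℝ v (u i x) * (inner ℝ (u i x) (u i x))⁻¹ : ℝ) • u i x := by
  conv_lhs => rw [hK.comm, hu.eq_sum hK hx v]
  rw [map_sum, Finset.sum_eq_single i]
  · rw [map_smul, hu.idem i x hx]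
  · intro j _ hj
    rw [map_smul, hu.orth i j hj.symm x hx, smul_zero]
  · simp

/-- The cubic form is diagonal in a canonical idempotent frame. -/
theorem IsCanonicalFrameOn.cubic_eq_sum (hK : IsStatistical K) (hu : IsCanonicalFrameOn K u U)
    {x : M} (hx : x ∈ U) (X Y Z : TangentSpace 𝓘(ℝ, E) x) :
    cubic K x X Y Z = ∑ i, (inner ℝ X (u i x) * inner ℝ Y (u i x) * inner ℝ Z (u i x)) *
      ((inner ℝ (u i x) (u i x))⁻¹ * (inner ℝ (u i x) (u i x))⁻¹ : ℝ) := by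
  have h : cubic K x X Y Z = inner ℝ Y (K x X Z) := hK.inner_left x X Y Z
  rw [h]
  conv_lhs => rw [hu.eq_sum hK hx Z]
  rw [map_sum, inner_sum]
  refine Finset.sum_congr rfl fun i _ => ?_
  rw [map_smul, hu.apply_left hK hx, real_inner_smul_right, real_inner_smul_right]
  ring

variable {D : Connection (E := E) M}

theorem IsCanonicalFrameOn.mdifferentiableAt (hu : IsCanonicalFrameOn K u U) (hU : IsOpen U)
    {x : M} (hx : x ∈ U) (i : Fin (Module.finrank ℝ E)) : MDiffAt (T% (u i)) x :=
  (hu.frame.contMDiffAt hU hx i).mdifferentiableAt (by simp)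

/-- If the cubic form is parallel, then so is every canonical idempotent frame. -/
theorem IsCanonicalFrameOn.parallelFieldsOn (hD : IsLeviCivita D) (hK : IsStatistical K)
    (hleft : ∀ x X Y Z, K x X (K x Y Z) = K x Y (K x X Z)) (hU : IsOpen U)
    (hu : IsCanonicalFrameOn K u U) (hC : ParallelCubicOn D K U) : ParallelFieldsOn D u U := by
  intro i x hx
  ext w
  have hi := hu.mdifferentiableAt hU hx i
  -- Apply ∇C = 0 to (u_i, u_i, u_j). The g(u_i, ∇u_j) terms cancel, and the first two slots
  -- contribute equally.
  have key : D (u i) x w = (2 : ℝ) • K x (u i x) (D (u i) x w) := by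
    refine hu.ext_inner hx fun j => ?_
    have hj := hu.mdifferentiableAt hU hx j
    have h := hC x hx w (u i) (u i) (u j) hi hi hj
    have hc : (fun y => cubic K y (u i y) (u i y) (u j y)) =ᶠ[𝓝 x]
        fun y => inner ℝ (u i y) (u j y) := by
      filter_upwards [hU.mem_nhds hx] with y hy
      simp only [cubic, hu.idem i y hy]
    rw [covDerivCubic, mvfderiv_congr hc, hD.metric x w _ _ hi hj] at h
    simp only [cubic, hu.idem i x hx, hK.comm x (D (u i) x w) (u i x)] at h
    rw [real_inner_smul_left]
    linarith
  -- With a = ∇_w u_i, multiplying `key` by u_i gives u_i ∘ a = 2 u_i ∘ (u_i ∘ a) = 2 u_i ∘ a.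
  have hz : K x (u i x) (D (u i) x w) = 0 := by
    have h := congrArg (K x (u i x)) key
    rw [map_smul, hK.comm x (u i x) (D (u i) x w), hleft, hu.idem i x hx, two_smul,
      left_eq_add] at h
    rw [hK.comm, h]
  rw [key, hz, smul_zero]
  rfl

theorem ParallelFieldsOn.mvfderiv_inner (hD : IsLeviCivita D) (hU : IsOpen U)
    (hu : IsCanonicalFrameOn K u U) (hp : ParallelFieldsOn D u U) {x : M} (hx : x ∈ U)
    (w : TangentSpace 𝓘(ℝ, E) x) {X : (x : M) → TangentSpace 𝓘(ℝ, E) x} (hX : MDiffAt (T% X) x)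
    (i : Fin (Module.finrank ℝ E)) :
    mvfderiv 𝓘(ℝ, E) (fun y => inner ℝ (X y) (u i y)) x w = inner ℝ (D X x w) (u i x) := by
  rw [hD.metric x w _ _ hX (hu.mdifferentiableAt hU hx i), hp i x hx]
  simp

variable [IsContMDiffRiemannianBundle 𝓘(ℝ, E) ∞ E (fun x : M => TangentSpace 𝓘(ℝ, E) x)]

/-- If a canonical idempotent frame is parallel, then so is the cubic form. -/
theorem ParallelFieldsOn.parallelCubicOn (hD : IsLeviCivita D) (hK : IsStatistical K)
    (hU : IsOpen U) (hu : IsCanonicalFrameOn K u U) (hp : ParallelFieldsOn D u U) :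
    ParallelCubicOn D K U := by
  intro x hx w X Y Z hX hY hZ
  have hd : ∀ {X : (x : M) → TangentSpace 𝓘(ℝ, E) x}, MDiffAt (T% X) x → ∀ i,
      MDifferentiableAt 𝓘(ℝ, E) 𝓘(ℝ, ℝ) (fun y => (inner ℝ (X y) (u i y) : ℝ)) x := fun hX i =>
    MDifferentiableAt.inner_bundle (IB := 𝓘(ℝ, E)) (F := E)
      (E := fun x : M => TangentSpace 𝓘(ℝ, E) x) (b := id) hX (hu.mdifferentiableAt hU hx i)
  have hinv : ∀ i, MDifferentiableAt 𝓘(ℝ, E) 𝓘(ℝ, ℝ)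
      (fun y => (inner ℝ (u i y) (u i y) : ℝ)⁻¹) x := fun i =>
    (hd (hu.mdifferentiableAt hU hx i) i).inv (hu.inner_self_ne_zero hx i)
  -- The norms of parallel fields are constant, so only the factors g(X,u_i), g(Y,u_i), g(Z,u_i) of
  -- the diagonal form get differentiated.
  have hinv' : ∀ i, mvfderiv 𝓘(ℝ, E) (fun y => (inner ℝ (u i y) (u i y) : ℝ)⁻¹) x w = 0 := by
    intro i
    refine mvfderiv_inv_of_eq_zero (hd (hu.mdifferentiableAt hU hx i) i)
      (hu.inner_self_ne_zero hx i) w ?_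
    rw [hp.mvfderiv_inner hD hU hu hx w (hu.mdifferentiableAt hU hx i), hp i x hx]
    simp
  have hXY : ∀ i, MDifferentiableAt 𝓘(ℝ, E) 𝓘(ℝ, ℝ)
      (fun y => (inner ℝ (X y) (u i y) * inner ℝ (Y y) (u i y) : ℝ)) x := fun i =>
    (hd hX i).mul (hd hY i)
  have hXYZ : ∀ i, MDifferentiableAt 𝓘(ℝ, E) 𝓘(ℝ, ℝ) (fun y =>
      (inner ℝ (X y) (u i y) * inner ℝ (Y y) (u i y) * inner ℝ (Z y) (u i y) : ℝ)) x := fun i =>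
    (hXY i).mul (hd hZ i)
  have hinv₂ : ∀ i, MDifferentiableAt 𝓘(ℝ, E) 𝓘(ℝ, ℝ) (fun y =>
      ((inner ℝ (u i y) (u i y))⁻¹ * (inner ℝ (u i y) (u i y))⁻¹ : ℝ)) x := fun i =>
    (hinv i).mul (hinv i)
  have hc : (fun y => cubic K y (X y) (Y y) (Z y)) =ᶠ[𝓝 x] fun y =>
      ∑ i, (inner ℝ (X y) (u i y) * inner ℝ (Y y) (u i y) * inner ℝ (Z y) (u i y)) *
        ((inner ℝ (u i y) (u i y))⁻¹ * (inner ℝ (u i y) (u i y))⁻¹ : ℝ) := by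
    filter_upwards [hU.mem_nhds hx] with y hy
    exact hu.cubic_eq_sum hK hy _ _ _
  rw [covDerivCubic, mvfderiv_congr hc, mvfderiv_finset_sum (f := fun i y =>
    (inner ℝ (X y) (u i y) * inner ℝ (Y y) (u i y) * inner ℝ (Z y) (u i y)) *
      ((inner ℝ (u i y) (u i y))⁻¹ * (inner ℝ (u i y) (u i y))⁻¹ : ℝ)) _
    fun i _ => (hXYZ i).mul (hinv₂ i)]
  simp only [hu.cubic_eq_sum hK hx, ← Finset.sum_sub_distrib]
  refine Finset.sum_eq_zero fun i _ => ?_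
  rw [mvfderiv_fun_mul (hXYZ i) (hinv₂ i), mvfderiv_fun_mul (hinv i) (hinv i),
    mvfderiv_fun_mul (hXY i) (hd hZ i), mvfderiv_fun_mul (hd hX i) (hd hY i)]
  simp only [add_apply, smul_apply, hinv', smul_eq_mul, hp.mvfderiv_inner hD hU hu hx w hX,
    hp.mvfderiv_inner hD hU hu hx w hY, hp.mvfderiv_inner hD hU hu hx w hZ]
  ring

end Frame

end

/-! ### Brackets as commutators of derivations, and flatness. -/

section

open VectorField

variable {E : Type*} [NormedAddCommGroup E] [NormedSpace ℝ E] [FiniteDimensional ℝ E]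
  {M : Type*} [TopologicalSpace M] [ChartedSpace E M]
  [IsManifold 𝓘(ℝ, E) ∞ M] [RiemannianBundle (fun x : M => TangentSpace 𝓘(ℝ, E) x)]
  [IsContMDiffRiemannianBundle 𝓘(ℝ, E) ∞ E (fun x : M => TangentSpace 𝓘(ℝ, E) x)]

theorem mdifferentiableAt_inner {X Y : (x : M) → TangentSpace 𝓘(ℝ, E) x} {x : M}
    (hX : MDiffAt (T% X) x) (hY : MDiffAt (T% Y) x) :
    MDifferentiableAt 𝓘(ℝ, E) 𝓘(ℝ, ℝ) (fun y => (inner ℝ (X y) (Y y) : ℝ)) x :=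
  MDifferentiableAt.inner_bundle (IB := 𝓘(ℝ, E)) (F := E)
    (E := fun x : M => TangentSpace 𝓘(ℝ, E) x) (b := id) hX hY

theorem mdifferentiableAt_mlieBracket {X Y : (x : M) → TangentSpace 𝓘(ℝ, E) x} {x : M}
    (hX : CMDiffAt 2 (T% X) x) (hY : CMDiffAt 2 (T% Y) x) :
    MDiffAt (T% (mlieBracket 𝓘(ℝ, E) X Y)) x := by
  have : CompleteSpace E := FiniteDimensional.complete ℝ E
  have : IsManifold 𝓘(ℝ, E) (((2 : ℕ∞) : WithTop ℕ∞) + 1) M :=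
    IsManifold.of_le (n := ∞) (by exact_mod_cast (le_top : (2 + 1 : ℕ∞) ≤ ⊤))
  have : IsManifold 𝓘(ℝ, E) (minSmoothness ℝ 2) M :=
    IsManifold.of_le (n := ∞) (by simpa using ENat.LEInfty.out)
  exact (ContMDiffAt.mlieBracket_vectorField (m := 1) (n := 2) hX hY
    (by simp [one_add_one_eq_two])).mdifferentiableAt (by simp)

theorem eventually_mlieBracket_smul_right {φ : M → ℝ} {Y W : (x : M) → TangentSpace 𝓘(ℝ, E) x}
    {x : M} (hφ : CMDiffAt 2 φ x) (hW : CMDiffAt 2 (T% W) x) :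
    ∀ᶠ y in 𝓝 x, mlieBracket 𝓘(ℝ, E) Y (φ • W) y =
      mvfderiv 𝓘(ℝ, E) φ y (Y y) • W y + φ y • mlieBracket 𝓘(ℝ, E) Y W y := by
  have : CompleteSpace E := FiniteDimensional.complete ℝ E
  filter_upwards [(contMDiffAt_iff_contMDiffAt_nhds (by simp)).mp hφ,
    (contMDiffAt_iff_contMDiffAt_nhds (by simp)).mp hW] with y h1 h2
  exact mlieBracket_smul_right (h1.mdifferentiableAt (by simp)) (h2.mdifferentiableAt (by simp))

/-- The derivative of a `C²` function along a `C²` vector field is differentiable. -/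
theorem mdifferentiableAt_mvfderiv_apply {φ : M → ℝ} {Y W : (x : M) → TangentSpace 𝓘(ℝ, E) x}
    {x : M} (hφ : CMDiffAt 2 φ x) (hY : CMDiffAt 2 (T% Y) x) (hW : CMDiffAt 2 (T% W) x)
    (hx : W x ≠ 0) :
    MDifferentiableAt 𝓘(ℝ, E) 𝓘(ℝ, ℝ) (fun y => mvfderiv 𝓘(ℝ, E) φ y (Y y)) x := by
  have hW1 := hW.mdifferentiableAt (n := 2) (by simp)
  have hφW : CMDiffAt 2 (T% (φ • W)) x := hφ.smul_section hW
  have h1 := mdifferentiableAt_inner (mdifferentiableAt_mlieBracket hY hφW) hW1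
  have h2 := mdifferentiableAt_inner (mdifferentiableAt_mlieBracket hY hW) hW1
  have h3 := mdifferentiableAt_inner hW1 hW1
  have h0 : (inner ℝ (W x) (W x) : ℝ) ≠ 0 := inner_self_ne_zero.mpr hx
  have hne : ∀ᶠ y in 𝓝 x, (inner ℝ (W y) (W y) : ℝ) ≠ 0 := h3.continuousAt.eventually_ne h0
  -- Pairing [Y, φW] = (Yφ)W + φ[Y, W] with W and dividing by g(W, W) ≠ 0 expresses Yφ through
  -- differentiable functions.
  refine ((h1.sub ((hφ.mdifferentiableAt (by simp)).mul h2)).mul (h3.inv h0)).congr_of_eventuallyEq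
    ?_
  filter_upwards [hne, eventually_mlieBracket_smul_right (Y := Y) hφ hW] with y hy h
  simp only [Pi.mul_apply, Pi.sub_apply, h, inner_add_left, real_inner_smul_left,
    add_sub_cancel_right]
  exact (mul_inv_cancel_right₀ hy _).symm

/-- The Lie bracket acts on `C²` functions as the commutator of derivations. -/
theorem mvfderiv_mlieBracket_apply {φ : M → ℝ} {X Y W : (x : M) → TangentSpace 𝓘(ℝ, E) x}
    {x : M} (hφ : CMDiffAt 2 φ x) (hX : CMDiffAt 2 (T% X) x) (hY : CMDiffAt 2 (T% Y) x)
    (hW : CMDiffAt 2 (T% W) x) (hx : W x ≠ 0) :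
    mvfderiv 𝓘(ℝ, E) φ x (mlieBracket 𝓘(ℝ, E) X Y x) =
      mvfderiv 𝓘(ℝ, E) (fun y => mvfderiv 𝓘(ℝ, E) φ y (Y y)) x (X x) -
        mvfderiv 𝓘(ℝ, E) (fun y => mvfderiv 𝓘(ℝ, E) φ y (X y)) x (Y x) := by
  have : CompleteSpace E := FiniteDimensional.complete ℝ E
  have : IsManifold 𝓘(ℝ, E) (minSmoothness ℝ 3) M := 
    IsManifold.of_le (n := ∞) (by simpa using ENat.LEInfty.out)
  have hφ1 : MDiffAt φ x := hφ.mdifferentiableAt (by simp)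
  have hW1 := hW.mdifferentiableAt (n := 2) (by simp)
  have hφW : CMDiffAt 2 (T% (φ • W)) x := hφ.smul_section hW
  have expand : ∀ {A B : (x : M) → TangentSpace 𝓘(ℝ, E) x}, CMDiffAt 2 (T% B) x →
      mlieBracket 𝓘(ℝ, E) A (mlieBracket 𝓘(ℝ, E) B (φ • W)) x =
        (mvfderiv 𝓘(ℝ, E) (fun y => mvfderiv 𝓘(ℝ, E) φ y (B y)) x (A x) • W x +
          mvfderiv 𝓘(ℝ, E) φ x (B x) • mlieBracket 𝓘(ℝ, E) A W x) +
        (mvfderiv 𝓘(ℝ, E) φ x (A x) • mlieBracket 𝓘(ℝ, E) B W x +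
          φ x • mlieBracket 𝓘(ℝ, E) A (mlieBracket 𝓘(ℝ, E) B W) x) := by
    intro A B hB
    have hd := mdifferentiableAt_mvfderiv_apply hφ hB hW hx
    have hBW := mdifferentiableAt_mlieBracket hB hW
    have he : mlieBracket 𝓘(ℝ, E) B (φ • W) =ᶠ[𝓝 x]
        (fun y => mvfderiv 𝓘(ℝ, E) φ y (B y)) • W + φ • mlieBracket 𝓘(ℝ, E) B W :=
      eventually_mlieBracket_smul_right hφ hW
    rw [EventuallyEq.mlieBracket_vectorField_eq (EventuallyEq.refl _ A) he,
      mlieBracket_add_right (hd.smul_section hW1) (hφ1.smul_section hBW),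
      mlieBracket_smul_right hd hW1, mlieBracket_smul_right hφ1 hBW]
  -- Compare the Jacobi identities for φW and for W. The cross terms (Bφ)[A, W] + (Aφ)[B, W] are
  -- symmetric in A and B, so only multiples of W survive.
  have hJ := leibniz_identity_mlieBracket_apply (I := 𝓘(ℝ, E)) (𝕜 := ℝ) (x := x)
    (U := X) (V := Y) (W := φ • W) (by simpa using hX) (by simpa using hY) (by simpa using hφW)
  have hJ' := leibniz_identity_mlieBracket_apply (I := 𝓘(ℝ, E)) (𝕜 := ℝ) (x := x)
    (U := X) (V := Y) (W := W) (by simpa using hX) (by simpa using hY) (by simpa using hW)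
  rw [expand hY, expand hX, mlieBracket_smul_right hφ1 hW1, hJ'] at hJ
  have hfin : (mvfderiv 𝓘(ℝ, E) φ x (mlieBracket 𝓘(ℝ, E) X Y x) -
      (mvfderiv 𝓘(ℝ, E) (fun y => mvfderiv 𝓘(ℝ, E) φ y (Y y)) x (X x) -
        mvfderiv 𝓘(ℝ, E) (fun y => mvfderiv 𝓘(ℝ, E) φ y (X y)) x (Y x))) • W x = 0 := by
    rw [← sub_eq_zero] at hJ
    rw [← neg_eq_zero, ← hJ]
    module
  exact sub_eq_zero.mp ((smul_eq_zero.mp hfin).resolve_right hx)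

/-- A Levi-Civita connection with a parallel canonical idempotent frame has vanishing curvature. -/
theorem ParallelFieldsOn.curvature_eq_zero {D : Connection (E := E) M} {K : Tensor12 (E := E) M}
    {U : Set M} {u : Fin (Module.finrank ℝ E) → (x : M) → TangentSpace 𝓘(ℝ, E) x}
    (hD : IsLeviCivita D) (hK : IsStatistical K) (hU : IsOpen U) (hu : IsCanonicalFrameOn K u U)
    (hp : ParallelFieldsOn D u U) {X Y Z : (x : M) → TangentSpace 𝓘(ℝ, E) x}
    (hX : CMDiff ∞ (T% X)) (hY : CMDiff ∞ (T% Y)) (hZ : CMDiff ∞ (T% Z)) {x : M} (hx : x ∈ U) :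
    curvature D X Y Z x = 0 := by
  have two_le : (2 : WithTop ℕ∞) ≤ ∞ := ENat.LEInfty.out
  have hu2 : ∀ i, CMDiffAt 2 (T% (u i)) x := fun i =>
    (hu.frame.contMDiffAt hU hx i).of_le two_le
  have hφ : ∀ i, ContMDiffAt 𝓘(ℝ, E) 𝓘(ℝ, ℝ) 2 (fun y => (inner ℝ (Z y) (u i y) : ℝ)) x :=
    fun i => ContMDiffAt.inner_bundle (IB := 𝓘(ℝ, E)) (F := E)
      (E := fun x : M => TangentSpace 𝓘(ℝ, E) x) (b := id) ((hZ x).of_le two_le) (hu2 i)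
  have hin : ∀ {y}, y ∈ U → ∀ v i, (inner ℝ (D Z y v) (u i y) : ℝ) =
      mvfderiv 𝓘(ℝ, E) (fun y => inner ℝ (Z y) (u i y)) y v := fun hy v i =>
    (hp.mvfderiv_inner hD hU hu hy v ((hZ _).mdifferentiableAt (by simp)) i).symm
  -- Metric compatibility is to be applied to ∇_Y Z, which must first be differentiable; this is
  -- read off its frame coefficients Y(g(Z,u_i)) / g(u_i,u_i).
  have hdiff : ∀ {Y : (x : M) → TangentSpace 𝓘(ℝ, E) x}, CMDiff ∞ (T% Y) →
      MDiffAt (T% (fun y => D Z y (Y y))) x := by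
    intro Y hY
    have h : ∀ i, MDiffAt (T% (fun y => (mvfderiv 𝓘(ℝ, E) (fun y => inner ℝ (Z y) (u i y)) y (Y y) *
        (inner ℝ (u i y) (u i y))⁻¹ : ℝ) • u i y)) x := fun i => by
      have hui := hu.mdifferentiableAt hU hx i
      exact ((mdifferentiableAt_mvfderiv_apply (hφ i) ((hY x).of_le two_le) (hu2 i)
        (hu.ne_zero hx i)).mul ((mdifferentiableAt_inner hui hui).inv
          (hu.inner_self_ne_zero hx i))).smul_section hui
    refine (MDifferentiableAt.sum_section (s := Finset.univ) fun i _ => h i).congr_of_eventuallyEq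
      ?_
    filter_upwards [hU.mem_nhds hx] with y hy
    simp only [← hin hy]
    rw [← hu.eq_sum hK hy]
  have hsnd : ∀ {A B : (x : M) → TangentSpace 𝓘(ℝ, E) x}, CMDiff ∞ (T% B) → ∀ i,
      (inner ℝ (D (fun y => D Z y (B y)) x (A x)) (u i x) : ℝ) =
        mvfderiv 𝓘(ℝ, E) (fun y => mvfderiv 𝓘(ℝ, E) (fun y => inner ℝ (Z y) (u i y)) y (B y)) x
          (A x) := by
    intro A B hB i
    rw [← hp.mvfderiv_inner hD hU hu hx (A x) (hdiff hB) i]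
    congr 1
    refine mvfderiv_congr ?_
    filter_upwards [hU.mem_nhds hx] with y hy using hin hy _ i
  refine hu.ext_inner hx fun i => ?_
  rw [curvature, inner_sub_left, inner_sub_left, hsnd hY, hsnd hX, hin hx,
    mvfderiv_mlieBracket_apply (hφ i) ((hX x).of_le two_le) ((hY x).of_le two_le) (hu2 i)
      (hu.ne_zero hx i), inner_zero_left]
  ring

end

end StatManifold

theorem corollary3p12 {E : Type*} [NormedAddCommGroup E] [NormedSpace ℝ E]
    [FiniteDimensional ℝ E] {M : Type*} [TopologicalSpace M] [T2Space M]
    [ChartedSpace E M] [IsManifold 𝓘(ℝ, E) ∞ M]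
    [RiemannianBundle (fun x : M => TangentSpace 𝓘(ℝ, E) x)]
    [IsContMDiffRiemannianBundle 𝓘(ℝ, E) ∞ E
      (fun x : M => TangentSpace 𝓘(ℝ, E) x)]
    (D : StatManifold.Connection (E := E) M) (hD : StatManifold.IsLeviCivita D)
    (K : StatManifold.Tensor12 (E := E) M) (hK : StatManifold.IsStatistical K)
    (hnd : StatManifold.Nondegenerate K)
    (hKK : ∀ (x : M) (X Y Z : TangentSpace 𝓘(ℝ, E) x), StatManifold.bracket K x X Y Z = 0) :
    -- around every point there is a canonical idempotent frame
    (∀ p : M, ∃ (U : Set M) (u : Fin (Module.finrank ℝ E) → (x : M) → TangentSpace 𝓘(ℝ, E) x),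
      IsOpen U ∧ p ∈ U ∧ StatManifold.IsCanonicalFrameOn K u U) ∧
    -- the equivalence on the domain of any canonical frame
    (∀ (U : Set M) (u : Fin (Module.finrank ℝ E) → (x : M) → TangentSpace 𝓘(ℝ, E) x),
      IsOpen U → StatManifold.IsCanonicalFrameOn K u U →
        (StatManifold.ParallelCubicOn D K U ↔ StatManifold.ParallelFieldsOn D u U)) ∧
    -- the equivalence on `M`
    (StatManifold.ParallelCubicOn D K Set.univ ↔
      ∀ (U : Set M) (u : Fin (Module.finrank ℝ E) → (x : M) → TangentSpace 𝓘(ℝ, E) x),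
        IsOpen U → StatManifold.IsCanonicalFrameOn K u U →
          StatManifold.ParallelFieldsOn D u U) ∧
    -- flatness of the metric
    (StatManifold.ParallelCubicOn D K Set.univ → StatManifold.IsFlat D) := by
  have hleft : ∀ x X Y Z, K x X (K x Y Z) = K x Y (K x X Z) := fun x X Y Z =>
    sub_eq_zero.mp (hKK x X Y Z)
  have hex := StatManifold.exists_isCanonicalFrameOn hK hnd hleft
  have hpar : StatManifold.ParallelCubicOn D K Set.univ →
      ∀ (U : Set M) (u : Fin (Module.finrank ℝ E) → (x : M) → TangentSpace 𝓘(ℝ, E) x),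
        IsOpen U → StatManifold.IsCanonicalFrameOn K u U → StatManifold.ParallelFieldsOn D u U :=
    fun hC U u hU hu => hu.parallelFieldsOn hD hK hleft hU fun x _ => hC x (Set.mem_univ x)
  refine ⟨hex, fun U u hU hu => ⟨hu.parallelFieldsOn hD hK hleft hU,
    fun hp => hp.parallelCubicOn hD hK hU hu⟩, ⟨hpar, fun h x _ => ?_⟩,
    fun hC X Y Z hX hY hZ x => ?_⟩
  · obtain ⟨U, u, hU, hx, hu⟩ := hex x
    exact (h U u hU hu).parallelCubicOn hD hK hU hu x hx
  · obtain ⟨U, u, hU, hx, hu⟩ := hex x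
    exact (hpar hC U u hU hu).curvature_eq_zero hD hK hU hu hX hY hZ hx
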